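/- Let $\Omega\subset\mathbb C$ be a domain (a nonempty connected open set). For $a,b\in\Omega$ let $\rho_\Omega(a,b)\in[0,\infty]$ be the infimum of the lengths of the curves that connect $a$ to $b$ within $\Omega$; here a curve is a continuous map $\gamma\colon[\alpha,\beta]\to\mathbb C$, and its length is the supremum of the sums $\sum_j|\gamma(t_j)-\gamma(t_{j-1})|$ over all finite partitions $\{t_j\}$ of $[\alpha,\beta]$. Let $\mathcal H^1$ be the one-dimensional Hausdorff measure on $\mathbb C$, normalized by $$\mathcal H^1(A)=\lim_{\delta\downarrow0}\inf\Big\{\sum_{i=1}^\infty\operatorname{diam}(E_i):\ A\subset\bigcup_{i=1}^\infty E_i,\ \operatorname{diam}(E_i)\le\delta\Big\}.$$ Then for all $a,b\in\Omega$, $$\rho_\Omega(a,b)\le|a-b|+\frac{\pi}{2}\,\mathcal H^1(\partial\Omega),$$ where the right-hand side is $\infty$ if $\mathcal H^1(\partial\Omega)=\infty$. -/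

import Mathlib

open Set MeasureTheory
open scoped ENNReal

/-- `IsCurveJoining A a b α β γ`: the restriction of `γ` to `[α, β]` is a curve (a continuous map)
from `a` to `b` whose image is contained in `A`. -/
def IsCurveJoining {X : Type*} [TopologicalSpace X] (A : Set X) (a b : X)
    (α β : ℝ) (γ : ℝ → X) : Prop :=
  α ≤ β ∧ ContinuousOn γ (Icc α β) ∧ MapsTo γ (Icc α β) A ∧ γ α = a ∧ γ β = b

/-- The length of the curve `γ : [α, β] → X`: the supremum of the sums of the distances between
consecutive points over all finite partitions. It may be `∞`. -/
noncomputable def curveLength {X : Type*} [PseudoEMetricSpace X] (α β : ℝ) (γ : ℝ → X) : ℝ≥0∞ :=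
  eVariationOn γ (Icc α β)

/-- The intrinsic metric `ρ_A(a, b)` on a set `A`: the infimum of the lengths of the curves that
connect `a` to `b` within `A`. It is `∞` if there is no such curve of finite length. -/
noncomputable def intrinsicEDist {X : Type*} [PseudoEMetricSpace X] (A : Set X) (a b : X) : ℝ≥0∞ :=
  sInf {l : ℝ≥0∞ | ∃ (α β : ℝ) (γ : ℝ → X), IsCurveJoining A a b α β γ ∧ l = curveLength α β γ}

/-!
The idea is to count levels of the distance function. Suppose `M ≤ ρ(a, b)` and let `f` be the
intrinsic distance to `a` truncated at `M`; it is locally `1`-Lipschitz on `Ω`, with `f a = 0` and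
`f b = M`. Cover the part of `∂Ω` in the disc of radius `M` around `a` by a finite union `U` of
convex polygons, so close to `∂Ω` that `closure U` misses a fixed path from `a` to `b` in `Ω`.
A set of diameter `d` lies in a polygon of perimeter at most `π d + η`
(`exists_isOpen_superset_hausdorffMeasure_frontier_le`), so `∂U` can be taken of length at most
`π H¹(∂Ω) + ε` (`exists_isOpen_superset_of_isCompact`).

Every level `t` strictly between `0` and `M` is attained on the segment `[a, b]` or attained at
least twice on `∂U` (`level_mem_image_segment_or_two_preimages`). Otherwise the level set of `t`
outside `U` is a compact set that misses `[a, b]` and meets `closure U` in at most one point; by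
Janiszewski's theorem (`exists_isPreconnected_disjoint_union`) its union with `closure U` does not
separate `a` from `b`, which is absurd because `f` passes the value `t` between them.

The levels of the first kind have measure at most `|a - b|`
(`volume_image_le_hausdorffMeasure`), those of the second kind at most half the length of `∂U`
(`volume_setOf_two_preimages_le`). Hence `M ≤ |a - b| + (π H¹(∂Ω) + ε) / 2`.

Janiszewski's theorem is proved through Eilenberg's criterion: a compact set `K` does not separate
`a` from `b` if and only if `(z - a) / (z - b)` has a continuous logarithm on `K`, and logarithms on
two compact sets can be glued when the sets have at most one common point.
-/

/-! ### Continuous logarithms and separation of the plane -/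

/-- `f` has a continuous branch of the logarithm on `K`. -/
def HasContinuousLogOn (f : ℂ → ℂ) (K : Set ℂ) : Prop :=
  ∃ u : ℂ → ℂ, ContinuousOn u K ∧ ∀ z ∈ K, Complex.exp (u z) = f z

lemma HasContinuousLogOn.congr {f g : ℂ → ℂ} {K : Set ℂ} (h : HasContinuousLogOn f K)
    (hfg : EqOn f g K) : HasContinuousLogOn g K := by
  obtain ⟨u, hu, hu'⟩ := h
  exact ⟨u, hu, fun z hz => (hu' z hz).trans (hfg hz)⟩

lemma HasContinuousLogOn.mul {f g : ℂ → ℂ} {K : Set ℂ} (hf : HasContinuousLogOn f K)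
    (hg : HasContinuousLogOn g K) : HasContinuousLogOn (fun z => f z * g z) K := by
  obtain ⟨u, hu, hu'⟩ := hf
  obtain ⟨v, hv, hv'⟩ := hg
  exact ⟨fun z => u z + v z, hu.add hv, fun z hz => by
    rw [Complex.exp_add, hu' z hz, hv' z hz]⟩

lemma HasContinuousLogOn.inv {f : ℂ → ℂ} {K : Set ℂ} (hf : HasContinuousLogOn f K) :
    HasContinuousLogOn (fun z => (f z)⁻¹) K := by
  obtain ⟨u, hu, hu'⟩ := hf
  exact ⟨fun z => -u z, hu.neg, fun z hz => by rw [Complex.exp_neg, hu' z hz]⟩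

lemma hasContinuousLogOn_of_norm_one_sub_lt {f : ℂ → ℂ} {K : Set ℂ} (hf : ContinuousOn f K)
    (h : ∀ z ∈ K, ‖1 - f z‖ < 1) : HasContinuousLogOn f K := by
  have hs : ∀ z ∈ K, f z ∈ Complex.slitPlane := fun z hz => by
    refine Complex.ball_one_subset_slitPlane ?_
    rw [mem_ball_iff_norm, norm_sub_rev]
    exact h z hz
  exact ⟨fun z => Complex.log (f z), hf.clog hs,
    fun z hz => Complex.exp_log (Complex.slitPlane_ne_zero (hs z hz))⟩

/-- The winding number obstruction: `z - p` has no continuous logarithm on a circle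
that encloses `p`. -/
lemma not_hasContinuousLogOn_sub_sphere {p : ℂ} {R : ℝ} (hp : ‖p‖ < R) :
    ¬ HasContinuousLogOn (fun z => z - p) (Metric.sphere 0 R) := by
  intro h
  have hR : 0 < R := (norm_nonneg p).trans_lt hp
  have hne : ∀ z ∈ Metric.sphere (0 : ℂ) R, z ≠ 0 := by
    rintro z hz rfl
    simp at hz; exact hR.ne hz
  have h1 : HasContinuousLogOn (fun z : ℂ => 1 - p / z) (Metric.sphere 0 R) := by
    refine hasContinuousLogOn_of_norm_one_sub_lt
      (continuousOn_const.sub (continuousOn_const.div continuousOn_id hne)) fun z hz => ?_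
    have : ‖z‖ = R := by simpa using hz
    rw [sub_sub_cancel, norm_div, this]
    exact (div_lt_one hR).2 hp
  -- dividing by `1 - p / z`, which stays in the right half plane, moves the centre to `0`
  obtain ⟨v, hv, hv'⟩ : HasContinuousLogOn (fun z => z) (Metric.sphere 0 R) := by
    refine (h.mul h1.inv).congr fun z hz => ?_
    have h0 := hne z hz
    have : z - p ≠ 0 := by
      intro h'
      rw [sub_eq_zero] at h'
      have : ‖z‖ = R := by simpa using hz
      rw [h'] at this; exact hp.ne this
    have h3 : 1 - p / z = (z - p) / z := by field_simp
    simp only [h3]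
    field_simp
  have hmem : ∀ θ : ℝ, (R : ℂ) * Complex.exp (θ * Complex.I) ∈ Metric.sphere (0 : ℂ) R := by
    intro θ
    simp [Complex.norm_exp_ofReal_mul_I, abs_of_pos hR]
  have hcont : Continuous fun θ : ℝ =>
      v ((R : ℂ) * Complex.exp (θ * Complex.I)) - θ * Complex.I := by
    refine Continuous.sub ?_ (by fun_prop)
    exact hv.comp_continuous (by fun_prop) hmem
  have hexp : ∀ θ : ℝ, Complex.exp
      (v ((R : ℂ) * Complex.exp (θ * Complex.I)) - θ * Complex.I) = R := by
    intro θ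
    rw [Complex.exp_sub, hv' _ (hmem θ), mul_div_assoc, div_self (Complex.exp_ne_zero _), mul_one]
  have := Complex.isCoveringMap_exp.const_of_comp hcont
    (fun θ θ' => Subtype.ext ((hexp θ).trans (hexp θ').symm)) 0 (2 * Real.pi)
  simp only [Complex.ofReal_mul, Complex.ofReal_ofNat, Complex.exp_two_pi_mul_I,
    Complex.ofReal_zero, zero_mul, Complex.exp_zero, sub_zero] at this
  have h2 : (2 * (Real.pi : ℂ) * Complex.I) = 0 := by
    linear_combination this
  exact Complex.two_pi_I_ne_zero h2

/-- Points in one component of the complement of `K` are joined by small steps, and for nearby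
points `(z - a) / (z - b)` is close to `1` on `K`. -/
lemma hasContinuousLogOn_of_isPreconnected {K C : Set ℂ} (hK : IsClosed K) (hC : IsPreconnected C)
    (hCK : Disjoint C K) {a b : ℂ} (ha : a ∈ C) (hb : b ∈ C) :
    HasContinuousLogOn (fun z => (z - a) / (z - b)) K := by
  refine hC.induction₂' (fun a b => HasContinuousLogOn (fun z => (z - a) / (z - b)) K)
    (fun x hx => ?_) (fun x y w hx hy hw hxy hyw => ?_) ha hb
  · have hxK : x ∈ Kᶜ := disjoint_left.1 hCK hx
    obtain ⟨r, hr, hball⟩ := Metric.isOpen_iff.1 hK.isOpen_compl x hxK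
    filter_upwards [mem_nhdsWithin_of_mem_nhds (Metric.ball_mem_nhds x hr)] with y hy
    have hxz : ∀ z ∈ K, z - x ≠ 0 := fun z hz h => hxK (by rwa [← sub_eq_zero.1 h])
    have key : HasContinuousLogOn (fun z => (z - y) / (z - x)) K := by
      refine hasContinuousLogOn_of_norm_one_sub_lt
        (ContinuousOn.div (by fun_prop) (by fun_prop) hxz) fun z hz => ?_
      have : 1 - (z - y) / (z - x) = (y - x) / (z - x) := by
        have := hxz z hz
        field_simp
        ring
      rw [this, norm_div, div_lt_one (norm_pos_iff.2 (hxz z hz))]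
      have hz' : z ∉ Metric.ball x r := fun h => hball h hz
      rw [mem_ball_iff_norm] at hy hz'
      exact hy.trans_le (not_lt.1 hz')
    exact ⟨key.inv.congr fun z _ => inv_div _ _, key⟩
  · refine (hxy.mul hyw).congr fun z hz => ?_
    have : z - y ≠ 0 := fun h => disjoint_left.1 hCK hy (by rwa [← sub_eq_zero.1 h])
    simp only
    field_simp

/-- If `(z - a) / (z - b)` has a continuous logarithm on the compact set `K`, then `K` does not
separate `a` from `b`. -/
lemma mem_connectedComponentIn_of_hasContinuousLogOn {K : Set ℂ} (hK : IsCompact K) {a b : ℂ}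
    (ha : a ∉ K) (h : HasContinuousLogOn (fun z => (z - a) / (z - b)) K) (hb : b ∉ K) :
    b ∈ connectedComponentIn Kᶜ a := by
  classical
  by_contra hbC
  set C := connectedComponentIn Kᶜ a with hCdef
  have haC : a ∈ C := mem_connectedComponentIn ha
  have hCo : IsOpen C := hK.isClosed.isOpen_compl.connectedComponentIn
  have hfr : frontier C ⊆ K := by
    intro z hz
    by_contra hzK
    have hzo : IsOpen (connectedComponentIn Kᶜ z) := hK.isClosed.isOpen_compl.connectedComponentIn
    obtain ⟨w, hwz, hwC⟩ := mem_closure_iff.1 hz.1 _ hzo (mem_connectedComponentIn hzK)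
    have : C = connectedComponentIn Kᶜ z := by
      rw [hCdef, connectedComponentIn_eq hwC, connectedComponentIn_eq hwz]
    rw [hCo.frontier_eq] at hz
    exact hz.2 (this ▸ mem_connectedComponentIn hzK)
  obtain ⟨u, hu, hu'⟩ := h
  obtain ⟨U, hU⟩ := ContinuousMap.exists_restrict_eq hK.isClosed
    ⟨K.domRestrict u, continuousOn_iff_continuous_domRestrict.1 hu⟩
  have hUu : ∀ z ∈ K, U z = u z := fun z hz => congr($hU ⟨z, hz⟩)
  -- a zero-free continuous function on the plane, hence one with a continuous logarithm
  let F : ℂ → ℂ := C.piecewise (fun z => z - b) (fun z => (z - a) * Complex.exp (-U z))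
  have hF : Continuous F := by
    refine Continuous.piecewise (fun z hz => ?_) (by fun_prop) (by fun_prop)
    have hzK := hfr hz
    have hza : z - a ≠ 0 := fun h => ha (by rwa [← sub_eq_zero.1 h])
    have hzb : z - b ≠ 0 := fun h => hb (by rwa [← sub_eq_zero.1 h])
    rw [Complex.exp_neg, hUu z hzK, hu' z hzK]
    field_simp
  have hF0 : ∀ z, F z ≠ 0 := by
    intro z
    by_cases hz : z ∈ C
    · simp only [F, piecewise_eq_of_mem _ _ _ hz]
      exact fun h => hbC (by rwa [← sub_eq_zero.1 h])
    · simp only [F, piecewise_eq_of_notMem _ _ _ hz]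
      exact mul_ne_zero (fun h => hz (by rwa [sub_eq_zero.1 h])) (Complex.exp_ne_zero _)
  obtain ⟨⟨g, hgc⟩, ⟨-, hg⟩, -⟩ := Complex.isCoveringMapOn_exp.existsUnique_continuousMap_lifts
    ⟨F, hF⟩ (a₀ := (0 : ℂ)) (e₀ := Complex.log (F 0)) (Complex.exp_log (hF0 0)) hF0
  have hg : ∀ z, Complex.exp (g z) = F z := fun z => congrFun hg z
  obtain ⟨R, hR⟩ := (hK.union (Set.toFinite {a, b}).isCompact).isBounded.subset_ball (0 : ℂ)
  have haR : ‖a‖ < R := by simpa using hR (show a ∈ K ∪ {a, b} by simp)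
  have hbR : ‖b‖ < R := by simpa using hR (show b ∈ K ∪ {a, b} by simp)
  have hSK : Metric.sphere (0 : ℂ) R ⊆ Kᶜ := fun z hz hzK => by
    have := hR (Or.inl hzK)
    simp only [mem_ball_zero_iff] at this
    simp only [mem_sphere_zero_iff_norm] at hz
    exact this.ne hz
  have hS : IsPreconnected (Metric.sphere (0 : ℂ) R) :=
    isPreconnected_sphere (by rw [Complex.rank_real_complex]; norm_num) _ _
  by_cases hd : ∃ x ∈ Metric.sphere (0 : ℂ) R, x ∈ C
  · obtain ⟨x, hx, hxC⟩ := hd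
    have hsub : Metric.sphere (0 : ℂ) R ⊆ C := by
      rw [hCdef, connectedComponentIn_eq hxC]
      exact hS.subset_connectedComponentIn hx hSK
    refine not_hasContinuousLogOn_sub_sphere hbR ⟨g, hgc.continuousOn, fun z hz => ?_⟩
    rw [hg]
    exact piecewise_eq_of_mem _ _ _ (hsub hz)
  · refine not_hasContinuousLogOn_sub_sphere haR
      ⟨fun z => g z + U z, by fun_prop, fun z hz => ?_⟩
    have : F z = (z - a) * Complex.exp (-U z) :=
      piecewise_eq_of_notMem _ _ _ fun h => hd ⟨z, hz, h⟩
    rw [Complex.exp_add, hg, this, mul_assoc, ← Complex.exp_add, neg_add_cancel, Complex.exp_zero,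
      mul_one]

/-- A case of Janiszewski's theorem: if neither of two compact sets separates `a` from `b`, and
they have at most one common point, then their union does not separate `a` from `b`. -/
theorem exists_isPreconnected_disjoint_union {A B C D : Set ℂ} (hA : IsCompact A)
    (hB : IsCompact B) (hAB : (A ∩ B).Subsingleton) {a b : ℂ}
    (hC : IsPreconnected C) (haC : a ∈ C) (hbC : b ∈ C) (hCA : Disjoint C A)
    (hD : IsPreconnected D) (haD : a ∈ D) (hbD : b ∈ D) (hDB : Disjoint D B) :
    ∃ E : Set ℂ, IsPreconnected E ∧ a ∈ E ∧ b ∈ E ∧ Disjoint E (A ∪ B) := by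
  classical
  have ha : a ∉ A ∪ B := by
    rintro (h | h)
    exacts [disjoint_left.1 hCA haC h, disjoint_left.1 hDB haD h]
  have hb : b ∉ A ∪ B := by
    rintro (h | h)
    exacts [disjoint_left.1 hCA hbC h, disjoint_left.1 hDB hbD h]
  refine ⟨connectedComponentIn (A ∪ B)ᶜ a, isPreconnected_connectedComponentIn,
    mem_connectedComponentIn ha, ?_, disjoint_left.2 fun z hz => connectedComponentIn_subset _ _ hz⟩
  refine mem_connectedComponentIn_of_hasContinuousLogOn (hA.union hB) ha ?_ hb
  obtain ⟨u, hu, hu'⟩ := hasContinuousLogOn_of_isPreconnected hA.isClosed hC hCA haC hbC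
  obtain ⟨v, hv, hv'⟩ := hasContinuousLogOn_of_isPreconnected hB.isClosed hD hDB haD hbD
  -- shift `v` by a constant period so that the logarithms agree at the common point
  obtain ⟨c, hc, hcAB⟩ : ∃ c : ℂ, Complex.exp c = 1 ∧ ∀ z ∈ A ∩ B, u z = v z + c := by
    rcases (A ∩ B).eq_empty_or_nonempty with h0 | ⟨x, hx⟩
    · exact ⟨0, Complex.exp_zero, by simp [h0]⟩
    · refine ⟨u x - v x, ?_, fun z hz => ?_⟩
      · rw [Complex.exp_sub, hu' x hx.1, ← hv' x hx.2, div_self (Complex.exp_ne_zero _)]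
      · rw [hAB hz hx]; ring
  have hvc : ∀ z ∈ B, A.piecewise u (fun z => v z + c) z = v z + c := by
    intro z hz
    by_cases hzA : z ∈ A
    · rw [piecewise_eq_of_mem _ _ _ hzA, hcAB z ⟨hzA, hz⟩]
    · rw [piecewise_eq_of_notMem _ _ _ hzA]
  refine ⟨A.piecewise u (fun z => v z + c), ?_, ?_⟩
  · refine ContinuousOn.union_of_isClosed ?_ ?_ hA.isClosed hB.isClosed
    · exact hu.congr fun z hz => piecewise_eq_of_mem _ _ _ hz
    · exact (hv.add continuousOn_const).congr hvc
  · rintro z (hz | hz)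
    · rw [piecewise_eq_of_mem _ _ _ hz, hu' z hz]
    · rw [hvc z hz, Complex.exp_add, hc, mul_one, hv' z hz]

/-! ### Circumscribed polygons -/

/-- The component of `z` in the direction `exp (θ * I)`. -/
noncomputable def dirCoord (θ : ℝ) (z : ℂ) : ℝ := z.re * Real.cos θ + z.im * Real.sin θ

@[fun_prop]
lemma continuous_dirCoord (θ : ℝ) : Continuous (dirCoord θ) := by
  unfold dirCoord; fun_prop

lemma dirCoord_add_two_pi_mul (θ : ℝ) (n : ℤ) (z : ℂ) :
    dirCoord (θ + n * (2 * Real.pi)) z = dirCoord θ z := by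
  simp [dirCoord]

lemma dirCoord_add_pi (θ : ℝ) (z : ℂ) : dirCoord (θ + Real.pi) z = -dirCoord θ z := by
  simp [dirCoord]; ring

lemma dirCoord_add_add_sub (θ α : ℝ) (z : ℂ) :
    dirCoord (θ + α) z + dirCoord (θ - α) z = 2 * Real.cos α * dirCoord θ z := by
  simp only [dirCoord, Real.cos_add, Real.sin_add, Real.cos_sub, Real.sin_sub]; ring

lemma dirCoord_sub (θ : ℝ) (z w : ℂ) : dirCoord θ (z - w) = dirCoord θ z - dirCoord θ w := by
  simp [dirCoord]; ring

lemma dirCoord_le_norm (θ : ℝ) (z : ℂ) : dirCoord θ z ≤ ‖z‖ := by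
  refine Real.le_sqrt_of_sq_le ?_ |>.trans_eq (Complex.norm_eq_sqrt_sq_add_sq z).symm
  unfold dirCoord
  nlinarith [sq_nonneg (z.re * Real.sin θ - z.im * Real.cos θ), Real.sin_sq_add_cos_sq θ,
    congrArg (fun t => t * (z.re ^ 2 + z.im ^ 2)) (Real.sin_sq_add_cos_sq θ)]

/-- The polygon cut out by the `N` half planes with normals `exp (2 π i k / N)` and
offsets `H (2 π k / N)`. -/
def halfPlanePolygon (N : ℕ) (H : ℝ → ℝ) : Set ℂ :=
  {z | ∀ k ∈ Finset.range N, dirCoord (k * (2 * Real.pi / N)) z < H (k * (2 * Real.pi / N))}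

lemma isOpen_halfPlanePolygon (N : ℕ) (H : ℝ → ℝ) : IsOpen (halfPlanePolygon N H) := by
  simp only [halfPlanePolygon, ofPred_forall]
  exact isOpen_biInter_finset fun k _ => isOpen_lt (by fun_prop) continuous_const

/-- The side of the polygon on the line with normal direction `θ` runs between the lines with
normal directions `θ - α` and `θ + α`; this is its length. -/
noncomputable def polygonSideLength (α : ℝ) (H : ℝ → ℝ) (θ : ℝ) : ℝ :=
  (H (θ + α) + H (θ - α) - 2 * Real.cos α * H θ) / Real.sin α

lemma hausdorffMeasure_polygon_side_le {α : ℝ} (hα : 0 < Real.sin α) (H : ℝ → ℝ) (θ : ℝ) :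
    μH[1] {z : ℂ | dirCoord θ z = H θ ∧ dirCoord (θ + α) z ≤ H (θ + α) ∧
      dirCoord (θ - α) z ≤ H (θ - α)} ≤ ENNReal.ofReal (polygonSideLength α H θ) := by
  set s₁ := -(H (θ - α) - H θ * Real.cos α) / Real.sin α with hs₁
  set s₂ := (H (θ + α) - H θ * Real.cos α) / Real.sin α with hs₂
  let φ : ℝ → ℂ := fun s => (H θ + s * Complex.I) * Complex.exp (θ * Complex.I)
  have hφ : LipschitzWith 1 φ := by
    refine LipschitzWith.of_dist_le_mul fun s t => ?_
    rw [dist_eq_norm, dist_eq_norm, show φ s - φ t =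
      ((s - t : ℝ) : ℂ) * Complex.I * Complex.exp (θ * Complex.I) by simp only [φ]; push_cast; ring]
    simp only [norm_mul, Complex.norm_exp_ofReal_mul_I, Complex.norm_I, Complex.norm_real,
      Real.norm_eq_abs, mul_one, NNReal.coe_one, one_mul, le_refl]
  have hsub : {z : ℂ | dirCoord θ z = H θ ∧ dirCoord (θ + α) z ≤ H (θ + α) ∧
      dirCoord (θ - α) z ≤ H (θ - α)} ⊆ φ '' Icc s₁ s₂ := by
    rintro z ⟨h0, h1, h2⟩
    have hsc := Real.sin_sq_add_cos_sq θ
    set s := z.im * Real.cos θ - z.re * Real.sin θ with hs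
    have e1 : dirCoord (θ + α) z = H θ * Real.cos α + s * Real.sin α := by
      rw [← h0, hs]; simp only [dirCoord, Real.cos_add, Real.sin_add]; ring
    have e2 : dirCoord (θ - α) z = H θ * Real.cos α - s * Real.sin α := by
      rw [← h0, hs]; simp only [dirCoord, Real.cos_sub, Real.sin_sub]; ring
    refine ⟨s, ⟨?_, ?_⟩, ?_⟩
    · rw [hs₁, div_le_iff₀ hα]; linarith
    · rw [hs₂, le_div_iff₀ hα]; linarith
    · simp only [φ]
      rw [← h0, hs]
      apply Complex.ext
      · simp [dirCoord, Complex.exp_ofReal_mul_I_re, Complex.exp_ofReal_mul_I_im]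
        rw [Complex.cos_ofReal_re, Complex.sin_ofReal_re]
        linear_combination z.re * hsc
      · simp [dirCoord, Complex.exp_ofReal_mul_I_re, Complex.exp_ofReal_mul_I_im]
        rw [Complex.cos_ofReal_re, Complex.sin_ofReal_re]
        linear_combination z.im * hsc
  calc _ ≤ μH[1] (φ '' Icc s₁ s₂) := measure_mono hsub
    _ ≤ μH[1] (Icc s₁ s₂) := by
      simpa using hφ.hausdorffMeasure_image_le zero_le_one (Icc s₁ s₂)
    _ = ENNReal.ofReal (s₂ - s₁) := by rw [hausdorffMeasure_real, Real.volume_Icc]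
    _ = _ := by
      congr 1
      rw [hs₁, hs₂, polygonSideLength]
      field_simp
      ring

lemma hausdorffMeasure_frontier_polygon_le {N : ℕ} (hN : 2 < N) {H : ℝ → ℝ}
    (hper : ∀ (θ : ℝ) (n : ℤ), H (θ + n * (2 * Real.pi)) = H θ) :
    μH[1] (frontier (halfPlanePolygon N H)) ≤ ∑ k ∈ Finset.range N,
      ENNReal.ofReal (polygonSideLength (2 * Real.pi / N) H (k * (2 * Real.pi / N))) := by
  set α := 2 * Real.pi / N with hα
  have hN0 : (0 : ℝ) < N := by positivity
  have hαpos : 0 < Real.sin α := by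
    refine Real.sin_pos_of_pos_of_lt_pi (by positivity) ?_
    rw [hα, div_lt_iff₀ hN0]
    have : (2 : ℝ) < N := by exact_mod_cast hN
    nlinarith [Real.pi_pos]
  have hsub : frontier (halfPlanePolygon N H) ⊆ ⋃ k ∈ Finset.range N,
      {z : ℂ | dirCoord (k * α) z = H (k * α) ∧ dirCoord (k * α + α) z ≤ H (k * α + α) ∧
        dirCoord (k * α - α) z ≤ H (k * α - α)} := by
    intro z hz
    rw [(isOpen_halfPlanePolygon N H).frontier_eq] at hz
    have hle : ∀ k ∈ Finset.range N, dirCoord (k * α) z ≤ H (k * α) := by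
      intro k hk
      have hcl : IsClosed {w : ℂ | dirCoord (k * α) w ≤ H (k * α)} :=
        isClosed_le (by fun_prop) continuous_const
      exact closure_minimal (fun w hw => (hw k hk).le) hcl hz.1
    have hle' : ∀ j : ℤ, dirCoord (j * α) z ≤ H (j * α) := by
      intro j
      have hNz : (0 : ℤ) < N := by positivity
      obtain ⟨k, hk⟩ := Int.eq_ofNat_of_zero_le (Int.emod_nonneg j hNz.ne')
      have hkN : k < N := by
        have := Int.emod_lt_of_pos j hNz
        rw [hk] at this; exact_mod_cast this
      have hj : (j : ℝ) * α = k * α + ((j / N : ℤ) : ℝ) * (2 * Real.pi) := by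
        have h1 : (j : ℝ) = N * ((j / N : ℤ) : ℝ) + k := by
          have := Int.mul_ediv_add_emod j N
          rw [hk] at this; exact_mod_cast this.symm
        nth_rewrite 1 [h1]
        rw [hα]; field_simp; ring
      rw [hj, dirCoord_add_two_pi_mul, hper]
      exact hle k (Finset.mem_range.2 hkN)
    obtain ⟨k, hk, hk'⟩ : ∃ k ∈ Finset.range N, H (k * α) ≤ dirCoord (k * α) z := by
      by_contra! hcon
      exact hz.2 hcon
    refine mem_biUnion hk ⟨(hle k hk).antisymm hk', ?_, ?_⟩
    · have := hle' (k + 1)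
      push_cast at this
      rwa [add_mul, one_mul] at this
    · have := hle' (k - 1)
      push_cast at this
      rwa [sub_mul, one_mul] at this
  calc _ ≤ _ := measure_mono hsub
    _ ≤ _ := measure_biUnion_finset_le _ _
    _ ≤ _ := Finset.sum_le_sum fun k _ => hausdorffMeasure_polygon_side_le hαpos H _

lemma sum_polygonSideLength (N : ℕ) {H : ℝ → ℝ}
    (hper : ∀ (θ : ℝ) (n : ℤ), H (θ + n * (2 * Real.pi)) = H θ) :
    ∑ k ∈ Finset.range N, polygonSideLength (2 * Real.pi / N) H (k * (2 * Real.pi / N)) =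
      (2 - 2 * Real.cos (2 * Real.pi / N)) / Real.sin (2 * Real.pi / N) *
        ∑ k ∈ Finset.range N, H (k * (2 * Real.pi / N)) := by
  rcases N.eq_zero_or_pos with rfl | hN
  · simp
  set α := 2 * Real.pi / N with hα
  have hNα : (N : ℝ) * α = 2 * Real.pi := by rw [hα]; field_simp
  have shift : ∀ g : ℕ → ℝ, g N = g 0 →
      ∑ k ∈ Finset.range N, g (k + 1) = ∑ k ∈ Finset.range N, g k := by
    intro g hg
    have h1 := Finset.sum_range_succ g N
    rw [Finset.sum_range_succ' g N] at h1
    linarith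
  have s1 : ∑ k ∈ Finset.range N, H (k * α + α) = ∑ k ∈ Finset.range N, H (k * α) := by
    have := shift (fun k => H (k * α)) (by simpa [hNα] using hper 0 1)
    simpa [add_mul] using this
  have s2 : ∑ k ∈ Finset.range N, H (k * α - α) = ∑ k ∈ Finset.range N, H (k * α) := by
    have := shift (fun k => H (k * α - α)) (by
      have := hper (0 * α - α) 1
      simp only [hNα, Nat.cast_zero]
      rw [← this]; congr 1; push_cast; ring)
    rw [← this]
    refine Finset.sum_congr rfl fun k _ => ?_
    congr 1; push_cast; ring
  simp only [polygonSideLength]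
  rw [← Finset.sum_div, Finset.sum_sub_distrib, Finset.sum_add_distrib, s1, s2, ← Finset.mul_sum]
  ring

/-- The support function of a planar set, as a function of the angle of the direction. -/
noncomputable def supportFun (E : Set ℂ) (θ : ℝ) : ℝ := sSup (dirCoord θ '' E)

section supportFun

variable {E : Set ℂ}

lemma dirCoord_le_supportFun (hE : Bornology.IsBounded E) {z : ℂ} (hz : z ∈ E) (θ : ℝ) :
    dirCoord θ z ≤ supportFun E θ := by
  obtain ⟨R, hR⟩ := hE.exists_norm_le
  refine le_csSup ⟨R, ?_⟩ (mem_image_of_mem _ hz)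
  rintro _ ⟨w, hw, rfl⟩
  exact (dirCoord_le_norm θ w).trans (hR w hw)

lemma supportFun_le (hne : E.Nonempty) {θ c : ℝ} (h : ∀ z ∈ E, dirCoord θ z ≤ c) :
    supportFun E θ ≤ c := by
  refine csSup_le (hne.image _) ?_
  rintro _ ⟨w, hw, rfl⟩
  exact h w hw

lemma supportFun_add_two_pi_mul (E : Set ℂ) (θ : ℝ) (n : ℤ) :
    supportFun E (θ + n * (2 * Real.pi)) = supportFun E θ := by
  unfold supportFun
  congr 2
  ext z
  exact dirCoord_add_two_pi_mul θ n z

/-- The width of a set in any direction is at most its diameter. -/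
lemma supportFun_add_supportFun_add_pi_le (hne : E.Nonempty) {d : ℝ}
    (hd : ∀ z ∈ E, ∀ w ∈ E, dist z w ≤ d) (θ : ℝ) :
    supportFun E θ + supportFun E (θ + Real.pi) ≤ d := by
  suffices supportFun E θ ≤ d - supportFun E (θ + Real.pi) by linarith
  refine supportFun_le hne fun z hz => ?_
  suffices supportFun E (θ + Real.pi) ≤ d - dirCoord θ z by linarith
  refine supportFun_le hne fun w hw => ?_
  have h1 := dirCoord_le_norm θ (z - w)
  have h2 := hd z hz w hw
  rw [dist_eq_norm] at h2
  rw [dirCoord_sub] at h1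
  rw [dirCoord_add_pi]
  linarith

lemma two_mul_cos_mul_supportFun_le (hE : Bornology.IsBounded E) (hne : E.Nonempty) {α : ℝ}
    (hα : 0 < Real.cos α) (θ : ℝ) :
    2 * Real.cos α * supportFun E θ ≤ supportFun E (θ + α) + supportFun E (θ - α) := by
  rw [← le_div_iff₀' (by positivity)]
  refine supportFun_le hne fun z hz => ?_
  rw [le_div_iff₀' (by positivity), ← dirCoord_add_add_sub]
  exact add_le_add (dirCoord_le_supportFun hE hz _) (dirCoord_le_supportFun hE hz _)

end supportFun

lemma tendsto_polygon_constant : Filter.Tendsto (fun q : ℕ =>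
    (2 - 2 * Real.cos (2 * Real.pi / ((4 * q : ℕ) : ℝ))) / Real.sin (2 * Real.pi / ((4 * q : ℕ) : ℝ))
      * (2 * q)) Filter.atTop (nhds Real.pi) := by
  have h1 : Filter.Tendsto (fun t : ℝ => t⁻¹ * Real.tan t) (nhdsWithin 0 {0}ᶜ) (nhds 1) := by
    have := (Real.hasDerivAt_tan (x := 0) (by simp)).tendsto_slope_zero
    simpa using this
  have h2 : Filter.Tendsto (fun q : ℕ => Real.pi / 4 / (q : ℝ)) Filter.atTop
      (nhdsWithin 0 {0}ᶜ) := by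
    refine tendsto_nhdsWithin_iff.2 ⟨tendsto_const_div_atTop_nhds_zero_nat _, ?_⟩
    filter_upwards [Filter.eventually_gt_atTop 0] with q hq
    have : (0 : ℝ) < q := by exact_mod_cast hq
    have hp := Real.pi_pos
    simp only [mem_compl_iff, mem_singleton_iff]
    positivity
  have h3 := (h1.comp h2).const_mul Real.pi
  rw [mul_one] at h3
  refine h3.congr' ?_
  filter_upwards [Filter.eventually_gt_atTop 0] with q hq
  have hq0 : (1 : ℝ) ≤ q := by exact_mod_cast hq
  have hp := Real.pi_pos
  have e : 2 * Real.pi / ((4 * q : ℕ) : ℝ) = 2 * (Real.pi / 4 / q) := by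
    push_cast; field_simp
  set t := Real.pi / 4 / (q : ℝ) with ht
  have ht0 : 0 < t := by positivity
  have ht1 : t < Real.pi / 2 := by
    rw [ht, div_lt_iff₀ (by positivity)]; nlinarith
  have hc : Real.cos t ≠ 0 := (Real.cos_pos_of_mem_Ioo ⟨by linarith, ht1⟩).ne'
  have hs : Real.sin t ≠ 0 := (Real.sin_pos_of_pos_of_lt_pi ht0 (by linarith)).ne'
  have hpt : Real.pi = 4 * q * t := by rw [ht]; field_simp
  have h2c : 2 - 2 * Real.cos (2 * t) = 4 * Real.sin t ^ 2 := by
    rw [Real.cos_two_mul]; nlinarith [Real.sin_sq_add_cos_sq t]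
  rw [e, Real.sin_two_mul, h2c, Function.comp, ← ht, Real.tan_eq_sin_div_cos]
  nth_rewrite 1 [hpt]
  field_simp

/-- A planar set of diameter at most `d` lies in an open polygon of perimeter at most `π d + η`:
a circumscribed polygon with many equally spaced side directions. By Cauchy's formula its perimeter
is about `π` times its mean width, and its widths are at most `d`. -/
theorem exists_isOpen_superset_hausdorffMeasure_frontier_le {E : Set ℂ} (hne : E.Nonempty) {d η : ℝ}
    (hd : ∀ z ∈ E, ∀ w ∈ E, dist z w ≤ d) (hη : 0 < η) :
    ∃ V : Set ℂ, IsOpen V ∧ E ⊆ V ∧ (∀ z ∈ V, ∀ w ∈ E, dist z w ≤ 2 * d + η) ∧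
      μH[1] (frontier V) ≤ ENNReal.ofReal (Real.pi * d + η) := by
  have hE : Bornology.IsBounded E := Metric.isBounded_iff.2 ⟨d, fun z hz w hw => hd z hz w hw⟩
  -- a number `4 q` of sides and a thickening `ε`
  obtain ⟨q, ε, hq, hε, hεη, hqε⟩ : ∃ (q : ℕ) (ε : ℝ), 1 < q ∧ 0 < ε ∧ 2 * ε ≤ η ∧
      (2 - 2 * Real.cos (2 * Real.pi / ((4 * q : ℕ) : ℝ))) /
        Real.sin (2 * Real.pi / ((4 * q : ℕ) : ℝ)) * (2 * q) * (d + 2 * ε) ≤ Real.pi * d + η := by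
    have h1 := tendsto_polygon_constant.mul_const d
    obtain ⟨q, hq1, hq2⟩ := ((h1.eventually (gt_mem_nhds (show Real.pi * d < Real.pi * d + η by
      linarith))).and (Filter.eventually_gt_atTop 1)).exists
    set c := (2 - 2 * Real.cos (2 * Real.pi / ((4 * q : ℕ) : ℝ))) /
        Real.sin (2 * Real.pi / ((4 * q : ℕ) : ℝ)) * (2 * q)
    have h2 : Filter.Tendsto (fun ε : ℝ => c * (d + 2 * ε)) (nhdsWithin 0 (Ioi 0))
        (nhds (c * (d + 2 * 0))) :=
      (Continuous.tendsto (by fun_prop) 0).mono_left nhdsWithin_le_nhds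
    rw [mul_zero, add_zero] at h2
    obtain ⟨ε, hε1, hε2, hε3⟩ := ((h2.eventually (gt_mem_nhds hq1)).and
      (Ioo_mem_nhdsGT (show (0 : ℝ) < η / 2 by positivity))).exists
    exact ⟨q, ε, hq2, hε2, by linarith, hε1.le⟩
  set N := 4 * q with hN
  have hq0 : (1 : ℝ) < q := by exact_mod_cast hq
  have hNq : (N : ℝ) = 4 * q := by rw [hN]; push_cast; ring
  set α := 2 * Real.pi / (N : ℝ) with hα
  have hp := Real.pi_pos
  have hα0 : 0 < α := by rw [hα, hNq]; positivity
  have hα1 : α < Real.pi / 2 := by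
    rw [hα, hNq, div_lt_iff₀ (by positivity)]; nlinarith
  have hcos : 0 < Real.cos α := Real.cos_pos_of_mem_Ioo ⟨by linarith, hα1⟩
  have hsin : 0 < Real.sin α := Real.sin_pos_of_pos_of_lt_pi hα0 (by linarith)
  have hqα : (q : ℝ) * α = Real.pi / 2 := by rw [hα, hNq]; field_simp; ring
  let H : ℝ → ℝ := fun θ => supportFun E θ + ε
  have hper : ∀ (θ : ℝ) (n : ℤ), H (θ + n * (2 * Real.pi)) = H θ := fun θ n => by
    simp only [H, supportFun_add_two_pi_mul]
  have hwidth : ∀ θ, H θ + H (θ + Real.pi) ≤ d + 2 * ε := fun θ => by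
    have := supportFun_add_supportFun_add_pi_le hne hd θ
    simp only [H]; linarith
  refine ⟨halfPlanePolygon N H, isOpen_halfPlanePolygon N H, ?_, ?_, ?_⟩
  · intro z hz k _
    have := dirCoord_le_supportFun hE hz (k * α)
    simp only [H]; linarith
  · -- the directions include the four axis directions
    intro z hz w hw
    have hz0 := hz 0 (by simp; omega)
    have hz1 := hz q (by simp; omega)
    have hz2 := hz (2 * q) (by simp; omega)
    have hz3 := hz (3 * q) (by simp; omega)
    rw [← hα] at hz0 hz1 hz2 hz3
    have e2 : ((2 * q : ℕ) : ℝ) * α = 0 + Real.pi := by push_cast; linarith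
    have e3 : ((3 * q : ℕ) : ℝ) * α = Real.pi / 2 + Real.pi := by push_cast; linarith
    rw [Nat.cast_zero, zero_mul] at hz0
    rw [hqα] at hz1
    rw [e2, dirCoord_add_pi] at hz2
    rw [e3, dirCoord_add_pi] at hz3
    have w0 := dirCoord_le_supportFun hE hw 0
    have w1 := dirCoord_le_supportFun hE hw (Real.pi / 2)
    have w2 := dirCoord_le_supportFun hE hw (0 + Real.pi)
    have w3 := dirCoord_le_supportFun hE hw (Real.pi / 2 + Real.pi)
    rw [dirCoord_add_pi] at w2 w3
    have s0 := supportFun_add_supportFun_add_pi_le hne hd 0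
    have s1 := supportFun_add_supportFun_add_pi_le hne hd (Real.pi / 2)
    simp only [H] at hz0 hz1 hz2 hz3
    simp only [dirCoord, Real.cos_zero, Real.sin_zero, Real.cos_pi_div_two,
      Real.sin_pi_div_two] at hz0 hz1 hz2 hz3 w0 w1 w2 w3
    have hre : |(z - w).re| ≤ d + ε := by
      rw [Complex.sub_re, abs_le]; constructor <;> linarith
    have him : |(z - w).im| ≤ d + ε := by
      rw [Complex.sub_im, abs_le]; constructor <;> linarith
    rw [dist_eq_norm]
    have := Complex.norm_le_abs_re_add_abs_im (z - w)
    linarith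
  · refine (hausdorffMeasure_frontier_polygon_le (by omega) hper).trans ?_
    rw [← hα, ← ENNReal.ofReal_sum_of_nonneg]
    · refine ENNReal.ofReal_le_ofReal ?_
      rw [hα, sum_polygonSideLength N hper, ← hα]
      refine le_trans ?_ hqε
      rw [mul_assoc]
      refine mul_le_mul_of_nonneg_left ?_ (div_nonneg ?_ hsin.le)
      · -- opposite sides combine to widths
        rw [show N = 2 * q + 2 * q by omega, Finset.sum_range_add, ← Finset.sum_add_distrib]
        refine (Finset.sum_le_card_nsmul _ _ (d + 2 * ε) fun k _ => ?_).trans_eq ?_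
        · have e : ((2 * q + k : ℕ) : ℝ) * α = k * α + Real.pi := by push_cast; linarith
          rw [e]
          exact hwidth (k * α)
        · rw [Finset.card_range, nsmul_eq_mul]; push_cast; ring
      · linarith [Real.cos_le_one α]
    · intro k _
      refine div_nonneg ?_ hsin.le
      have := two_mul_cos_mul_supportFun_le hE hne hcos (k * α)
      simp only [H]
      nlinarith [Real.cos_le_one α]

/-! ### One-dimensional measure of values of locally Lipschitz functions -/

lemma tsum_measure_inter_eq {X ι : Type*} [MeasurableSpace X] [Countable ι] (μ : Measure X)
    {D : ι → Set X} (hD : ∀ i, MeasurableSet (D i)) (hdisj : Pairwise (Function.onFun Disjoint D))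
    (S : Set X) : ∑' i, μ (D i ∩ S) = μ ((⋃ i, D i) ∩ S) := by
  rw [← Measure.restrict_apply (MeasurableSet.iUnion hD), measure_iUnion hdisj hD]
  exact tsum_congr fun i => (Measure.restrict_apply (hD i)).symm

/-- A locally `1`-Lipschitz real function does not increase one-dimensional measure. -/
lemma volume_image_le_hausdorffMeasure {X : Type*} [MetricSpace X] [SecondCountableTopology X]
    [MeasurableSpace X] [BorelSpace X] {f : X → ℝ} {S : Set X}
    (hf : ∀ x ∈ S, ∃ U ∈ nhds x, LipschitzOnWith 1 f U) :
    volume (f '' S) ≤ μH[1] S := by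
  choose! U hU hfU using hf
  obtain ⟨t, htS, htc, hcov⟩ := TopologicalSpace.countable_cover_nhdsWithin
    (f := fun x => interior (U x)) (s := S)
    fun x hx => mem_nhdsWithin_of_mem_nhds (interior_mem_nhds.2 (hU x hx))
  rcases S.eq_empty_or_nonempty with rfl | hS
  · simp
  have htne : t.Nonempty := by
    obtain ⟨x, hx⟩ := hS
    obtain ⟨y, hy, -⟩ := mem_iUnion₂.1 (hcov hx)
    exact ⟨y, hy⟩
  obtain ⟨e, rfl⟩ := htc.exists_eq_range htne
  set W : ℕ → Set X := fun n => interior (U (e n)) with hW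
  have hDm : ∀ n, MeasurableSet (disjointed W n) := fun n =>
    MeasurableSet.disjointed (fun n => isOpen_interior.measurableSet) n
  have hcov' : S ⊆ ⋃ n, disjointed W n := by
    rw [iUnion_disjointed]
    simpa [hW] using hcov
  calc volume (f '' S) ≤ volume (⋃ n, f '' (disjointed W n ∩ S)) := by
        refine measure_mono ?_
        rw [← image_iUnion, ← iUnion_inter]
        exact image_mono fun x hx => ⟨hcov' hx, hx⟩
    _ ≤ ∑' n, volume (f '' (disjointed W n ∩ S)) := measure_iUnion_le _
    _ ≤ ∑' n, μH[1] (disjointed W n ∩ S) := by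
        refine ENNReal.tsum_le_tsum fun n => ?_
        rw [← hausdorffMeasure_real]
        have hsub : disjointed W n ∩ S ⊆ U (e n) := fun x hx =>
          interior_subset (disjointed_subset W n hx.1)
        simpa using ((hfU (e n) (htS ⟨n, rfl⟩)).mono hsub).hausdorffMeasure_image_le zero_le_one
    _ = μH[1] ((⋃ n, disjointed W n) ∩ S) :=
        tsum_measure_inter_eq _ hDm (disjoint_disjointed W) S
    _ ≤ μH[1] S := measure_mono inter_subset_right

/-- The index of the half-open square of side `1 / n` in the standard grid that contains `z`
(for `n = 0` there is a single cell). -/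
noncomputable def gridCell (n : ℕ) (z : ℂ) : ℤ × ℤ := (⌊n * z.re⌋, ⌊n * z.im⌋)

@[fun_prop]
lemma measurable_gridCell (n : ℕ) : Measurable (gridCell n) := by
  unfold gridCell
  exact (Int.measurable_floor.comp (by fun_prop)).prodMk (Int.measurable_floor.comp (by fun_prop))

lemma eventually_gridCell_ne {x y : ℂ} (h : x ≠ y) :
    ∀ᶠ n : ℕ in Filter.atTop, gridCell n x ≠ gridCell n y := by
  have key : ∀ s t : ℝ, s ≠ t → ∀ᶠ n : ℕ in Filter.atTop, ⌊n * s⌋ ≠ ⌊n * t⌋ := by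
    intro s t hst
    obtain ⟨N, hN⟩ := exists_nat_gt (1 / |s - t|)
    filter_upwards [Filter.eventually_ge_atTop N] with n hn heq
    have h1 := Int.abs_sub_lt_one_of_floor_eq_floor heq
    have h0 : 0 < |s - t| := abs_pos.2 (sub_ne_zero.2 hst)
    have h2 : 1 / |s - t| < n := hN.trans_le (by exact_mod_cast hn)
    rw [div_lt_iff₀ h0] at h2
    rw [← mul_sub, abs_mul, Nat.abs_cast] at h1
    exact h1.not_gt h2
  by_cases hre : x.re = y.re
  · have him : x.im ≠ y.im := fun him => h (Complex.ext hre him)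
    filter_upwards [key _ _ him] with n hn heq
    exact hn congr(($heq).2)
  · filter_upwards [key _ _ hre] with n hn heq
    exact hn congr(($heq).1)

/-- The values that a locally `1`-Lipschitz function takes at least twice on `S` fill at most half
of the length of `S`. -/
theorem volume_setOf_two_preimages_le {f : ℂ → ℝ} {S : Set ℂ}
    (hf : ∀ x ∈ S, ∃ U ∈ nhds x, LipschitzOnWith 1 f U) :
    volume {t | ∃ x ∈ S, ∃ y ∈ S, x ≠ y ∧ f x = t ∧ f y = t} ≤ μH[1] S / 2 := by
  let T : ℕ → Set ℝ := fun n =>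
    {t | ∃ x ∈ S, ∃ y ∈ S, gridCell n x ≠ gridCell n y ∧ f x = t ∧ f y = t}
  have hT : ∀ n, volume (T n) ≤ μH[1] S / 2 := by
    intro n
    rw [ENNReal.le_div_iff_mul_le (Or.inl two_ne_zero) (Or.inl ENNReal.ofNat_ne_top), mul_comm]
    let D : ℤ × ℤ → Set ℂ := fun i => gridCell n ⁻¹' {i}
    have hDm : ∀ i, MeasurableSet (D i) := fun i =>
      measurable_gridCell n (measurableSet_singleton i)
    have hDd : Pairwise (Function.onFun Disjoint D) := fun i j hij =>
      disjoint_left.2 fun x hi hj => hij (hi.symm.trans hj)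
    let G : ℤ × ℤ → Set ℝ := fun i => toMeasurable volume (f '' (D i ∩ S))
    have hGm : ∀ i, MeasurableSet (G i) := fun i => measurableSet_toMeasurable _ _
    have hsub : T n ⊆ {t | 2 ≤ ∑' i, (G i).indicator (1 : ℝ → ℝ≥0∞) t} := by
      rintro t ⟨x, hx, y, hy, hne, hxt, hyt⟩
      have hxG : t ∈ G (gridCell n x) := subset_toMeasurable _ _ ⟨x, ⟨rfl, hx⟩, hxt⟩
      have hyG : t ∈ G (gridCell n y) := subset_toMeasurable _ _ ⟨y, ⟨rfl, hy⟩, hyt⟩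
      have := ENNReal.sum_le_tsum (f := fun i => (G i).indicator (1 : ℝ → ℝ≥0∞) t)
        {gridCell n x, gridCell n y}
      rw [Finset.sum_pair hne, indicator_of_mem hxG, indicator_of_mem hyG] at this
      refine le_trans (le_of_eq ?_) this
      norm_num
    calc 2 * volume (T n) ≤ 2 * volume {t | 2 ≤ ∑' i, (G i).indicator (1 : ℝ → ℝ≥0∞) t} := by
          gcongr
      _ ≤ ∫⁻ t, ∑' i, (G i).indicator (1 : ℝ → ℝ≥0∞) t :=
          mul_meas_ge_le_lintegral
            (Measurable.tsum fun i => measurable_one.indicator (hGm i)) 2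
      _ = ∑' i, volume (G i) := by
          rw [lintegral_tsum fun i => (measurable_one.indicator (hGm i)).aemeasurable]
          exact tsum_congr fun i => lintegral_indicator_one (hGm i)
      _ = ∑' i, volume (f '' (D i ∩ S)) := by simp only [G, measure_toMeasurable]
      _ ≤ ∑' i, μH[1] (D i ∩ S) := ENNReal.tsum_le_tsum fun i =>
          volume_image_le_hausdorffMeasure fun x hx => hf x hx.2
      _ = μH[1] ((⋃ i, D i) ∩ S) := tsum_measure_inter_eq _ hDm hDd S
      _ ≤ μH[1] S := measure_mono inter_subset_right
  have hsub : {t | ∃ x ∈ S, ∃ y ∈ S, x ≠ y ∧ f x = t ∧ f y = t} ⊆ ⋃ n, ⋂ m ≥ n, T m := by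
    rintro t ⟨x, hx, y, hy, hne, hxt, hyt⟩
    obtain ⟨n, hn⟩ := Filter.eventually_atTop.1 (eventually_gridCell_ne hne)
    exact mem_iUnion.2 ⟨n, mem_iInter₂.2 fun m hm => ⟨x, hx, y, hy, hn m hm, hxt, hyt⟩⟩
  have hmono : Monotone fun n => ⋂ m ≥ n, T m := fun n k hnk =>
    biInter_subset_biInter_left fun m (hm : k ≤ m) => hnk.trans hm
  refine (measure_mono hsub).trans ?_
  rw [hmono.measure_iUnion]
  exact iSup_le fun n => (measure_mono (biInter_subset_of_mem (le_refl n))).trans (hT n)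

/-! ### Neighbourhoods with short boundary -/

/-- A compact planar set of finite length has arbitrarily tight open neighbourhoods whose boundary
is at most `π` times as long, up to a small error. -/
theorem exists_isOpen_superset_of_isCompact {K : Set ℂ} (hK : IsCompact K)
    (hfin : μH[1] K ≠ ⊤) {δ ε : ℝ} (hδ : 0 < δ) (hε : 0 < ε) :
    ∃ U : Set ℂ, IsOpen U ∧ K ⊆ U ∧ U ⊆ Metric.cthickening δ K ∧
      μH[1] (frontier U) ≤ ENNReal.ofReal Real.pi * μH[1] K + ENNReal.ofReal ε := by
  have hp := Real.pi_pos
  set ε₁ : ℝ := ε / (2 * Real.pi) with hε₁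
  have hε₁0 : 0 < ε₁ := by positivity
  obtain ⟨E, hKE, hEd, hEs⟩ : ∃ E : ℕ → Set ℂ, K ⊆ ⋃ n, E n ∧
      (∀ n, Metric.ediam (E n) ≤ ENNReal.ofReal (δ / 4)) ∧
      ∑' n, ⨆ _ : (E n).Nonempty, Metric.ediam (E n) ^ (1 : ℝ) ≤
        μH[1] K + ENNReal.ofReal ε₁ := by
    have h1 : (⨅ (t : ℕ → Set ℂ) (_ : K ⊆ ⋃ n, t n)
        (_ : ∀ n, Metric.ediam (t n) ≤ ENNReal.ofReal (δ / 4)),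
          ∑' n, ⨆ _ : (t n).Nonempty, Metric.ediam (t n) ^ (1 : ℝ)) < μH[1] K + ENNReal.ofReal ε₁ := by
      refine lt_of_le_of_lt ?_ (ENNReal.lt_add_right hfin (ENNReal.ofReal_pos.2 hε₁0).ne')
      rw [Measure.hausdorffMeasure_apply]
      exact le_iSup₂_of_le (ENNReal.ofReal (δ / 4)) (ENNReal.ofReal_pos.2 (by positivity)) le_rfl
    simp only [iInf_lt_iff] at h1
    obtain ⟨E, h2, h3, h4⟩ := h1
    exact ⟨E, h2, h3, h4.le⟩
  obtain ⟨η, hη0, hηs⟩ := ENNReal.exists_pos_sum_of_countable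
    (ENNReal.ofReal_pos.2 (half_pos hε)).ne' ℕ
  have hV : ∀ n, ∃ V : Set ℂ, IsOpen V ∧ K ∩ E n ⊆ V ∧ V ⊆ Metric.cthickening δ K ∧
      μH[1] (frontier V) ≤ ENNReal.ofReal Real.pi *
        (⨆ _ : (E n).Nonempty, Metric.ediam (E n) ^ (1 : ℝ)) + η n := by
    intro n
    rcases (K ∩ E n).eq_empty_or_nonempty with h0 | ⟨w, hwK, hwE⟩
    · exact ⟨∅, isOpen_empty, h0.subset, empty_subset _, by simp⟩
    have hne : (E n).Nonempty := ⟨w, hwE⟩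
    have hfinE : Metric.ediam (E n) ≠ ⊤ := ne_top_of_le_ne_top ENNReal.ofReal_ne_top (hEd n)
    have hdiam : Metric.diam (E n) ≤ δ / 4 :=
      ENNReal.toReal_le_of_le_ofReal (by positivity) (hEd n)
    have hbdd : Bornology.IsBounded (E n) := Metric.isBounded_iff_ediam_ne_top.2 hfinE
    have hη1 : 0 < min (η n : ℝ) (δ / 2) := lt_min (by exact_mod_cast hη0 n) (by positivity)
    obtain ⟨V, hVo, hEV, hVd, hVm⟩ := exists_isOpen_superset_hausdorffMeasure_frontier_le hne
      (fun z hz w hw => Metric.dist_le_diam_of_mem hbdd hz hw) hη1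
    refine ⟨V, hVo, inter_subset_right.trans hEV, fun z hz => ?_, hVm.trans ?_⟩
    · refine Metric.mem_cthickening_of_dist_le z w δ K hwK ((hVd z hz w hwE).trans ?_)
      linarith [min_le_right (η n : ℝ) (δ / 2)]
    · rw [iSup_pos hne, ENNReal.rpow_one, ENNReal.ofReal_add (by positivity) hη1.le,
        ENNReal.ofReal_mul hp.le, Metric.diam, ENNReal.ofReal_toReal hfinE]
      gcongr
      exact (ENNReal.ofReal_le_ofReal (min_le_left _ _)).trans_eq ENNReal.ofReal_coe_nnreal
  choose V hVo hKV hVK hVm using hV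
  obtain ⟨s, hs⟩ := hK.elim_finite_subcover V hVo fun z hz => by
    obtain ⟨n, hn⟩ := mem_iUnion.1 (hKE hz)
    exact mem_iUnion.2 ⟨n, hKV n ⟨hz, hn⟩⟩
  refine ⟨⋃ n ∈ s, V n, isOpen_biUnion fun n _ => hVo n, hs, iUnion₂_subset fun n _ => hVK n, ?_⟩
  have hfr : frontier (⋃ n ∈ s, V n) ⊆ ⋃ n ∈ s, frontier (V n) := by
    have hUo : IsOpen (⋃ n ∈ s, V n) := isOpen_biUnion fun n _ => hVo n
    rw [hUo.frontier_eq, s.closure_biUnion]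
    rintro z ⟨hz, hz'⟩
    obtain ⟨n, hn, hzn⟩ := mem_iUnion₂.1 hz
    refine mem_iUnion₂.2 ⟨n, hn, ?_⟩
    rw [(hVo n).frontier_eq]
    exact ⟨hzn, fun h => hz' (mem_iUnion₂.2 ⟨n, hn, h⟩)⟩
  calc μH[1] (frontier (⋃ n ∈ s, V n))
      ≤ ∑ n ∈ s, μH[1] (frontier (V n)) :=
        (measure_mono hfr).trans (measure_biUnion_finset_le _ _)
    _ ≤ ∑ n ∈ s, (ENNReal.ofReal Real.pi *
        (⨆ _ : (E n).Nonempty, Metric.ediam (E n) ^ (1 : ℝ)) + η n) :=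
        Finset.sum_le_sum fun n _ => hVm n
    _ ≤ ∑' n, (ENNReal.ofReal Real.pi *
        (⨆ _ : (E n).Nonempty, Metric.ediam (E n) ^ (1 : ℝ)) + η n) := ENNReal.sum_le_tsum s
    _ = ENNReal.ofReal Real.pi *
        ∑' n, (⨆ _ : (E n).Nonempty, Metric.ediam (E n) ^ (1 : ℝ)) + ∑' n, (η n : ℝ≥0∞) := by
        rw [ENNReal.tsum_add, ENNReal.tsum_mul_left]
    _ ≤ ENNReal.ofReal Real.pi * (μH[1] K + ENNReal.ofReal ε₁) + ENNReal.ofReal (ε / 2) := by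
        gcongr
    _ = _ := by
        rw [mul_add, ← ENNReal.ofReal_mul hp.le, add_assoc,
          ← ENNReal.ofReal_add (by positivity) (by positivity)]
        congr 2
        rw [hε₁]
        field_simp
        ring

/-! ### The intrinsic distance -/

lemma edist_le_intrinsicEDist {X : Type*} [PseudoEMetricSpace X] (A : Set X) (a b : X) :
    edist a b ≤ intrinsicEDist A a b := by
  refine le_sInf ?_
  rintro _ ⟨α, β, γ, ⟨hαβ, -, -, rfl, rfl⟩, rfl⟩
  exact eVariationOn.edist_le γ (left_mem_Icc.2 hαβ) (right_mem_Icc.2 hαβ)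

lemma intrinsicEDist_self {X : Type*} [PseudoEMetricSpace X] {A : Set X} {a : X} (ha : a ∈ A) :
    intrinsicEDist A a a = 0 := by
  refine le_antisymm (sInf_le ⟨0, 0, fun _ => a, ⟨le_rfl, continuousOn_const, fun _ _ => ha,
    rfl, rfl⟩, ?_⟩) zero_le
  simp [curveLength]

lemma eVariationOn_lineMap_sub_le {E : Type*} [NormedAddCommGroup E] [NormedSpace ℝ E] (x y : E)
    (β : ℝ) : eVariationOn (fun t : ℝ => AffineMap.lineMap x y (t - β)) (Icc β (β + 1)) ≤
      edist x y := by
  have h1 : LipschitzWith (nndist x y) (AffineMap.lineMap x y : ℝ → E) := lipschitzWith_lineMap x y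
  have h2 := (h1.lipschitzOnWith (s := univ)).comp_eVariationOn_le
    (mapsTo_univ (fun t : ℝ => t - β) (Icc β (β + 1)))
  have h3 : eVariationOn (fun t : ℝ => t - β) (Icc β (β + 1)) ≤ 1 := by
    have hm : MonotoneOn (fun t : ℝ => t - β) (Icc β (β + 1)) := fun s _ t _ h =>
      sub_le_sub_right h β
    have := (hm.eVariationOn_eq (left_mem_Icc.2 (by linarith))
      (right_mem_Icc.2 (by linarith))).le
    simpa using this
  refine h2.trans ((mul_le_mul_right h3 _).trans_eq ?_)
  rw [mul_one, edist_nndist]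

/-- Prolonging curves from `a` to `x` by a segment `[x, y]`. -/
lemma intrinsicEDist_le_add_edist {E : Type*} [NormedAddCommGroup E] [NormedSpace ℝ E] {A : Set E}
    {x y : E} (hxy : segment ℝ x y ⊆ A) (a : E) :
    intrinsicEDist A a y ≤ intrinsicEDist A a x + edist x y := by
  classical
  rw [intrinsicEDist, intrinsicEDist, ENNReal.sInf_add]
  refine le_iInf₂ ?_
  rintro _ ⟨α, β, γ, ⟨hαβ, hγ, hγA, rfl, rfl⟩, rfl⟩
  set γ' : ℝ → E := fun t => if t ≤ β then γ t else AffineMap.lineMap (γ β) y (t - β) with hγ'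
  have e1 : EqOn γ' γ (Icc α β) := fun t ht => if_pos ht.2
  have e2 : EqOn γ' (fun t => AffineMap.lineMap (γ β) y (t - β)) (Icc β (β + 1)) := by
    intro t ht
    rcases ht.1.eq_or_lt with rfl | h
    · simp [hγ']
    · exact if_neg h.not_ge
  have hU : Icc α β ∪ Icc β (β + 1) = Icc α (β + 1) := Icc_union_Icc_eq_Icc hαβ (by linarith)
  refine sInf_le_of_le ⟨α, β + 1, γ', ⟨by linarith, ?_, ?_, ?_, ?_⟩, rfl⟩ ?_
  · rw [← hU]
    refine ContinuousOn.union_of_isClosed (hγ.congr e1) (ContinuousOn.congr ?_ e2) isClosed_Icc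
      isClosed_Icc
    exact (AffineMap.lineMap_continuous.comp (by fun_prop)).continuousOn
  · rw [← hU]
    rintro t (ht | ht)
    · rw [e1 ht]; exact hγA ht
    · rw [e2 ht]
      refine hxy ?_
      rw [segment_eq_image_lineMap]
      exact ⟨t - β, ⟨by linarith [ht.1], by linarith [ht.2]⟩, rfl⟩
  · exact e1 (left_mem_Icc.2 hαβ)
  · rw [e2 (right_mem_Icc.2 (by linarith))]
    simp
  · have := eVariationOn.Icc_add_Icc γ' hαβ (show β ≤ β + 1 by linarith) (mem_univ β)
    simp only [univ_inter] at this
    rw [curveLength, curveLength, ← this, eVariationOn.eq_of_eqOn e1, eVariationOn.eq_of_eqOn e2]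
    gcongr
    exact eVariationOn_lineMap_sub_le _ _ _

/-! ### The truncated intrinsic distance -/

/-- The intrinsic distance to `a`, truncated at `M`. -/
noncomputable def truncatedIntrinsicDist (Ω : Set ℂ) (a : ℂ) (M : ℝ) (x : ℂ) : ℝ :=
  (min (intrinsicEDist Ω a x) (ENNReal.ofReal M)).toReal

section truncatedIntrinsicDist

variable {Ω : Set ℂ} {a : ℂ} {M : ℝ}

lemma ofReal_truncatedIntrinsicDist (x : ℂ) :
    ENNReal.ofReal (truncatedIntrinsicDist Ω a M x) =
      min (intrinsicEDist Ω a x) (ENNReal.ofReal M) :=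
  ENNReal.ofReal_toReal (ne_top_of_le_ne_top ENNReal.ofReal_ne_top (min_le_right _ _))

lemma dist_le_truncatedIntrinsicDist {x : ℂ} (h : truncatedIntrinsicDist Ω a M x < M) :
    dist x a ≤ truncatedIntrinsicDist Ω a M x := by
  have h0 : 0 ≤ truncatedIntrinsicDist Ω a M x := ENNReal.toReal_nonneg
  have h1 := (ENNReal.ofReal_lt_ofReal_iff (h0.trans_lt h)).2 h
  rw [ofReal_truncatedIntrinsicDist, min_lt_iff] at h1
  have h2 : min (intrinsicEDist Ω a x) (ENNReal.ofReal M) = intrinsicEDist Ω a x :=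
    min_eq_left (h1.resolve_right (lt_irrefl _)).le
  rw [← ENNReal.ofReal_le_ofReal_iff h0, ofReal_truncatedIntrinsicDist, h2, ← edist_dist,
    edist_comm]
  exact edist_le_intrinsicEDist Ω a x

lemma truncatedIntrinsicDist_le_add {x y : ℂ} (hxy : segment ℝ x y ⊆ Ω) :
    truncatedIntrinsicDist Ω a M y ≤ truncatedIntrinsicDist Ω a M x + dist x y := by
  have h0 : 0 ≤ truncatedIntrinsicDist Ω a M x := ENNReal.toReal_nonneg
  rw [← ENNReal.ofReal_le_ofReal_iff (by positivity), ENNReal.ofReal_add h0 dist_nonneg,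
    ofReal_truncatedIntrinsicDist, ofReal_truncatedIntrinsicDist, ← edist_dist, ← min_add_add_right]
  exact min_le_min (intrinsicEDist_le_add_edist hxy a) le_self_add

lemma exists_lipschitzOnWith_truncatedIntrinsicDist (hΩ : IsOpen Ω) {x : ℂ} (hx : x ∈ Ω) :
    ∃ U ∈ nhds x, LipschitzOnWith 1 (truncatedIntrinsicDist Ω a M) U := by
  obtain ⟨r, hr, hball⟩ := Metric.isOpen_iff.1 hΩ x hx
  refine ⟨Metric.ball x r, Metric.ball_mem_nhds x hr, LipschitzOnWith.of_le_add fun y hy z hz => ?_⟩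
  rw [dist_comm]
  exact truncatedIntrinsicDist_le_add (((convex_ball x r).segment_subset hz hy).trans hball)

lemma continuousAt_truncatedIntrinsicDist (hΩ : IsOpen Ω) {x : ℂ} (hx : x ∈ Ω) :
    ContinuousAt (truncatedIntrinsicDist Ω a M) x := by
  obtain ⟨U, hU, hL⟩ := exists_lipschitzOnWith_truncatedIntrinsicDist (a := a) (M := M) hΩ hx
  exact hL.continuousOn.continuousAt hU

end truncatedIntrinsicDist

/-! ### Level sets of the distance and the estimate -/

/-- Let `U` be an open set that covers `∂Ω` near `a`, and suppose its closure does not separate `a`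
from `b`. A level `t` of the truncated distance that is attained neither on the segment `[a, b]`
nor twice on `∂U` gives a compact level set `L` outside `U` with at most one point on `∂U`. Neither
`L` nor `closure U` separates `a` from `b`, so their union does not either, although the distance
must pass the value `t` on the way from `a` to `b`. -/
lemma level_mem_image_segment_or_two_preimages {Ω U D : Set ℂ} {a b : ℂ} {M t : ℝ}
    (hΩ : IsOpen Ω) (ha : a ∈ Ω) (hb : ENNReal.ofReal M ≤ intrinsicEDist Ω a b)
    (hU : IsOpen U) (hUbdd : Bornology.IsBounded U)
    (hcov : frontier Ω ∩ Metric.closedBall a M ⊆ U)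
    (hD : IsPreconnected D) (haD : a ∈ D) (hbD : b ∈ D) (hDU : Disjoint D (closure U))
    (ht : t ∈ Ioo 0 M) :
    t ∈ truncatedIntrinsicDist Ω a M '' (segment ℝ a b ∩ Ω) ∪
      {t | ∃ x ∈ frontier U ∩ Ω, ∃ y ∈ frontier U ∩ Ω, x ≠ y ∧
        truncatedIntrinsicDist Ω a M x = t ∧ truncatedIntrinsicDist Ω a M y = t} := by
  by_contra hcon
  rw [mem_union, not_or] at hcon
  obtain ⟨hseg, htwo⟩ := hcon
  set f := truncatedIntrinsicDist Ω a M with hf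
  have hM0 : 0 < M := ht.1.trans ht.2
  have hfa : f a = 0 := by
    simp [hf, truncatedIntrinsicDist, intrinsicEDist_self ha]
  have hfb : f b = M := by
    rw [hf, truncatedIntrinsicDist, min_eq_right hb, ENNReal.toReal_ofReal hM0.le]
  -- outside `U`, limits of points of `Ω` at distance at most `t < M` stay in `Ω`
  have hclos : ∀ S ⊆ Ω \ U, (∀ x ∈ S, f x ≤ t) → ∀ z ∈ closure S,
      z ∈ Ω \ U ∧ f z ∈ closure (f '' S) := by
    intro S hS hSt z hz
    have hzU : z ∈ Uᶜ := closure_minimal (fun x hx => (hS hx).2) hU.isClosed_compl hz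
    have hzM : z ∈ Metric.closedBall a M := by
      refine closure_minimal (fun x hx => ?_) Metric.isClosed_closedBall hz
      have := hSt x hx
      exact (dist_le_truncatedIntrinsicDist (this.trans_lt ht.2)).trans (this.trans ht.2.le)
    have hzΩ : z ∈ Ω := by
      by_contra h
      refine hzU (hcov ⟨?_, hzM⟩)
      rw [hΩ.frontier_eq]
      exact ⟨closure_mono (fun x hx => (hS hx).1) hz, h⟩
    exact ⟨⟨hzΩ, hzU⟩,
      (continuousAt_truncatedIntrinsicDist hΩ hzΩ).continuousWithinAt.mem_closure_image hz⟩
  set L : Set ℂ := {x | x ∈ Ω \ U ∧ f x = t} with hLdef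
  have hLc : IsCompact L := by
    refine Metric.isCompact_of_isClosed_isBounded (isClosed_of_closure_subset fun z hz => ?_) ?_
    · obtain ⟨h1, h2⟩ := hclos L (fun x hx => hx.1) (fun x hx => hx.2.le) z hz
      refine ⟨h1, ?_⟩
      have : f z ∈ ({t} : Set ℝ) := by
        refine closure_minimal ?_ isClosed_singleton h2
        rintro _ ⟨x, hx, rfl⟩
        exact hx.2
      exact this
    · refine Metric.isBounded_closedBall.subset (?_ : L ⊆ Metric.closedBall a M)
      intro x hx
      exact (dist_le_truncatedIntrinsicDist (hx.2.trans_lt ht.2)).trans (hx.2.trans_le ht.2.le)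
  have hLU : (L ∩ closure U).Subsingleton := by
    intro x hx y hy
    by_contra hne
    have hfr : ∀ w ∈ L ∩ closure U, w ∈ frontier U ∩ Ω := fun w hw => by
      rw [hU.frontier_eq]
      exact ⟨⟨hw.2, hw.1.1.2⟩, hw.1.1.1⟩
    exact htwo ⟨x, hfr x hx, y, hfr y hy, hne, hx.1.2, hy.1.2⟩
  have hsegL : Disjoint (segment ℝ a b) L :=
    disjoint_left.2 fun x hx hxL => hseg ⟨x, ⟨hx, hxL.1.1⟩, hxL.2⟩
  obtain ⟨E, hE, haE, hbE, hEd⟩ := exists_isPreconnected_disjoint_union hLc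
    hUbdd.isCompact_closure hLU (convex_segment a b).isPreconnected (left_mem_segment ℝ a b)
    (right_mem_segment ℝ a b) hsegL hD haD hbD hDU
  -- the sublevel set of `t` is relatively clopen in `E`
  set P : Set ℂ := (Ω ∩ f ⁻¹' Iio t) \ closure U with hPdef
  have hP : IsOpen P := by
    refine IsOpen.sdiff (ContinuousOn.isOpen_inter_preimage ?_ hΩ isOpen_Iio) isClosed_closure
    exact fun x hx => (continuousAt_truncatedIntrinsicDist hΩ hx).continuousWithinAt
  have hEU : ∀ z ∈ E, z ∉ closure U := fun z hz h => disjoint_left.1 hEd hz (Or.inr h)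
  have hEP : E ⊆ P := by
    refine hE.subset_of_closure_inter_subset hP ⟨a, haE, ⟨ha, ?_⟩, hEU a haE⟩ ?_
    · simpa [hfa] using ht.1
    · rintro z ⟨hz, hzE⟩
      obtain ⟨h1, h2⟩ := hclos P (fun x hx => ⟨hx.1.1, fun h => hx.2 (subset_closure h)⟩)
        (fun x hx => (show f x < t from hx.1.2).le) z hz
      have h3 : f z ≤ t := by
        refine closure_minimal (t := Iic t) ?_ isClosed_Iic h2
        rintro _ ⟨x, hx, rfl⟩
        exact (show f x < t from hx.1.2).le
      refine ⟨⟨h1.1, h3.lt_of_ne fun h => ?_⟩, hEU z hzE⟩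
      exact disjoint_left.1 hEd hzE (Or.inl ⟨h1, h⟩)
  have : f b < t := (hEP hbE).1.2
  rw [hfb] at this
  exact this.not_gt ht.2

/-- The estimate with an error `ε` for every `M` below the intrinsic distance. The radius `M` of the
compact piece of `∂Ω` that is covered suffices, because points at distance less than `M` from `a`
lie in that ball; so `∂Ω` need not be bounded. -/
lemma ofReal_le_of_le_intrinsicEDist {Ω : Set ℂ} (hΩ : IsOpen Ω) (hc : IsConnected Ω) {a b : ℂ}
    (ha : a ∈ Ω) (hb : b ∈ Ω) (hfin : μH[1] (frontier Ω) ≠ ⊤) {M ε : ℝ}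
    (hM : ENNReal.ofReal M ≤ intrinsicEDist Ω a b) (hε : 0 < ε) :
    ENNReal.ofReal M ≤ edist a b +
      (ENNReal.ofReal Real.pi * μH[1] (frontier Ω) + ENNReal.ofReal ε) / 2 := by
  obtain ⟨γ, hγ⟩ := (hΩ.isConnected_iff_isPathConnected.1 hc).joinedIn a ha b hb
  have hD : IsCompact (range γ) := isCompact_range γ.continuous
  obtain ⟨δ, hδ, hδΩ⟩ := hD.exists_cthickening_subset_open hΩ (range_subset_iff.2 hγ)
  set K := frontier Ω ∩ Metric.closedBall a M with hKdef
  have hK : IsCompact K := (isCompact_closedBall a M).inter_left isClosed_frontier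
  have hKle : μH[1] K ≤ μH[1] (frontier Ω) := measure_mono inter_subset_left
  obtain ⟨U, hU, hKU, hUK, hUm⟩ := exists_isOpen_superset_of_isCompact hK
    (ne_top_of_le_ne_top hfin hKle) hδ hε
  have hDU : Disjoint (range γ) (closure U) := by
    refine disjoint_left.2 fun z hz hzU => ?_
    have h1 := closure_minimal hUK Metric.isClosed_cthickening hzU
    rw [hK.cthickening_eq_biUnion_closedBall hδ.le] at h1
    obtain ⟨w, hwK, hzw⟩ := mem_iUnion₂.1 h1
    have hwΩ : w ∈ Ω := hδΩ (Metric.mem_cthickening_of_dist_le w z δ _ hz (by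
      rw [dist_comm]; exact hzw))
    have := hwK.1
    rw [hΩ.frontier_eq] at this
    exact this.2 hwΩ
  set f := truncatedIntrinsicDist Ω a M
  have hlip : ∀ x ∈ Ω, ∃ V ∈ nhds x, LipschitzOnWith 1 f V := fun x hx =>
    exists_lipschitzOnWith_truncatedIntrinsicDist hΩ hx
  calc ENNReal.ofReal M = volume (Ioo 0 M) := by rw [Real.volume_Ioo, sub_zero]
    _ ≤ volume (f '' (segment ℝ a b ∩ Ω)) + volume {t | ∃ x ∈ frontier U ∩ Ω,
        ∃ y ∈ frontier U ∩ Ω, x ≠ y ∧ f x = t ∧ f y = t} := by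
        refine (measure_mono fun t ht => ?_).trans (measure_union_le _ _)
        exact level_mem_image_segment_or_two_preimages hΩ ha hM hU
          (hK.isBounded.cthickening.subset hUK) hKU (isPreconnected_range γ.continuous)
          ⟨0, γ.source⟩ ⟨1, γ.target⟩ hDU ht
    _ ≤ μH[1] (segment ℝ a b) + μH[1] (frontier U) / 2 := by
        refine add_le_add ?_ ?_
        · exact (volume_image_le_hausdorffMeasure fun x hx => hlip x hx.2).trans
            (measure_mono inter_subset_left)
        · exact (volume_setOf_two_preimages_le fun x hx => hlip x hx.2).trans
            (ENNReal.div_le_div_right (measure_mono inter_subset_left) _)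
    _ ≤ _ := by
        rw [hausdorffMeasure_segment]
        gcongr
        exact hUm.trans (by gcongr)

theorem lemma4p1 (Ω : Set ℂ) (hΩ_open : IsOpen Ω) (hΩ_conn : IsConnected Ω)
    (a b : ℂ) (ha : a ∈ Ω) (hb : b ∈ Ω) :
    intrinsicEDist Ω a b ≤
      ENNReal.ofReal ‖a - b‖ + ENNReal.ofReal (Real.pi / 2) * μH[1] (frontier Ω) := by
  by_cases hfin : μH[1] (frontier Ω) = ⊤
  · rw [hfin, ENNReal.mul_top (ENNReal.ofReal_pos.2 (by positivity)).ne', add_top]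
    exact le_top
  refine le_of_forall_lt fun c hc => ?_
  by_contra! hcon
  obtain ⟨M, -, hM1, hM2⟩ := ENNReal.lt_iff_exists_real_btwn.1 hc
  refine (hcon.trans_lt hM1).not_ge (ENNReal.le_of_forall_pos_le_add fun ε hε _ => ?_)
  refine (ofReal_le_of_le_intrinsicEDist hΩ_open hΩ_conn ha hb hfin hM2.le
    (show (0 : ℝ) < 2 * ε by positivity)).trans_eq ?_
  have h2 : ENNReal.ofReal (2 * ε) = 2 * ε := by
    rw [ENNReal.ofReal_mul zero_le_two, ENNReal.ofReal_coe_nnreal, ENNReal.ofReal_ofNat]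
  have h3 : (2 * ε : ℝ≥0∞) / 2 = ε := by
    rw [ENNReal.mul_div_right_comm, ENNReal.div_self two_ne_zero ENNReal.ofNat_ne_top, one_mul]
  rw [edist_dist, dist_eq_norm, add_assoc, h2, ENNReal.add_div, h3,
    ENNReal.ofReal_div_of_pos two_pos, ENNReal.ofReal_ofNat, ENNReal.mul_div_right_comm]
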